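/- For positive integers $n$ and $k$, let $C_n(1,k)$ be the circulant graph with vertex set $\mathbb{Z}/n\mathbb{Z}$ in which two distinct vertices are adjacent if and only if their difference, in one of the two orders, is congruent to $1$ or $k$ modulo $n$. The distinguishing chromatic number $\chi_D(G)$ of a graph $G$ is the minimum number of colors in a proper vertex coloring of $G$ such that the only automorphism of $G$ preserving the color of every vertex is the identity. Let $D_n$ denote the dihedral group of order $2n$. Theorem. Let $n$ and $k$ be odd integers with $2 < k < (n-1)/2$. If $\operatorname{Aut}(C_n(1,k)) \cong D_n$, then $\chi_D(C_n(1,k)) = 3$. -/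

import Mathlib

namespace SimpleGraph

/-- The circulant graph `C_n(1, k)`: the vertices are the residues modulo `n`, and two distinct
vertices are adjacent if and only if their difference, in one of the two orders, is `1` or `k`
modulo `n`. -/
abbrev circulantOneK (n k : ℕ) : SimpleGraph (ZMod n) :=
  circulantGraph {(1 : ZMod n), (k : ZMod n)}

/-- A proper coloring is distinguishing if the identity is the only automorphism of the graph that
preserves the color of every vertex. -/
def Coloring.IsDistinguishing {V : Type*} {G : SimpleGraph V} {α : Type*}
    (c : G.Coloring α) : Prop :=
  ∀ φ : G ≃g G, (∀ v : V, c (φ v) = c v) → ∀ v : V, φ v = v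

/-- The graph has a distinguishing proper coloring with colors from a set of size `r`. -/
def DistinguishingColorable {V : Type*} (G : SimpleGraph V) (r : ℕ) : Prop :=
  ∃ c : G.Coloring (Fin r), c.IsDistinguishing

/-- The distinguishing chromatic number: the smallest number of colors in a distinguishing proper
coloring, and `⊤` if finitely many colors never suffice. -/
noncomputable def distinguishingChromaticNumber {V : Type*}
    (G : SimpleGraph V) : ℕ∞ :=
  ⨅ r ∈ {r : ℕ | G.DistinguishingColorable r}, (r : ℕ∞)

end SimpleGraph

namespace SimpleGraph

/-! ### Automorphisms and the lower bound -/

section Automorphisms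

variable {n k : ℕ}

/-! An odd cycle forces three colors. Since the automorphism group has order `2n`, only translations
and reflections occur, and reflections never preserve a proper coloring; so a proper 3-coloring
without a nonzero period suffices. Such a coloring is an integer height of slope `(n - 2m)/n =
3t/n`, reduced mod 3 (`slopeHeight`). If `3k ≤ n`, slope `3/n` works and has no period. Otherwise
`t` is chosen so that the rise over `k` steps is within 1 of a multiple of 6. All neighbors of a
suitable vertex then share one color, so that vertex can be recolored, which destroys any periods.
-/

theorem circulantOneK_adj_add_one (hn : 1 < n) (x : ZMod n) :
    (circulantOneK n k).Adj x (x + 1) := by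
  have : Fact (1 < n) := ⟨hn⟩
  rw [circulantGraph_adj]
  exact ⟨by simp, Or.inr (by simp)⟩

/-- The action of the dihedral group on the vertices of a circulant graph. -/
def dihedralIso (n k : ℕ) : DihedralGroup n → (circulantOneK n k ≃g circulantOneK n k)
  | .r b => ⟨Equiv.addRight b, by intro x y; simp [circulantGraph_adj]⟩
  | .sr b => ⟨Equiv.subLeft b, by
      intro x y
      simp only [circulantGraph_adj, Equiv.subLeft_apply, sub_sub_sub_cancel_left,
        sub_right_inj]
      tauto⟩

theorem dihedralIso_injective (hn : 2 < n) : Function.Injective (dihedralIso n k) := by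
  have h2 : (2 : ZMod n) ≠ 0 := by
    intro h
    have := (ZMod.natCast_eq_zero_iff 2 n).1 (by exact_mod_cast h)
    exact absurd (Nat.le_of_dvd (by norm_num) this) (by omega)
  have key (a b : ZMod n) (h : ∀ x : ZMod n, x + a = b - x) : False := by
    have h0 := h 0
    have h1 := h 1
    exact h2 (by linear_combination h1 - h0)
  rintro (a | a) (b | b) hab
  · have := DFunLike.congr_fun hab (0 : ZMod n)
    have : (0 : ZMod n) + a = 0 + b := this
    simpa using this
  · exact (key a b fun x => DFunLike.congr_fun hab x).elim
  · exact (key b a fun x => (DFunLike.congr_fun hab x).symm).elim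
  · have := DFunLike.congr_fun hab (0 : ZMod n)
    have : a - (0 : ZMod n) = b - 0 := this
    simpa using this

/-- Counting suffices: composing `dihedralIso` with the given isomorphism yields an injection of a
finite set into itself. -/
theorem circulantOneK_iso_of_mulEquiv_dihedralGroup (hn : 2 < n)
    (hAut : Nonempty ((circulantOneK n k ≃g circulantOneK n k) ≃* DihedralGroup n))
    (φ : circulantOneK n k ≃g circulantOneK n k) :
    (∃ b, ∀ x, φ x = x + b) ∨ ∃ b, ∀ x, φ x = b - x := by
  have : NeZero n := ⟨by omega⟩
  obtain ⟨e⟩ := hAut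
  have hinj : Function.Injective (fun g => e (dihedralIso n k g)) :=
    e.injective.comp (dihedralIso_injective hn)
  obtain ⟨g, hg⟩ := Finite.injective_iff_surjective.1 hinj (e φ)
  obtain rfl : dihedralIso n k g = φ := e.injective hg
  cases g with
  | r b => exact Or.inl ⟨b, fun x => rfl⟩
  | sr b => exact Or.inr ⟨b, fun x => rfl⟩

/-- A reflection of an odd cycle exchanges the ends of an edge, so only translations have to be
excluded. -/
theorem Coloring.isDistinguishing_of_translation (hn : 1 < n) (hodd : Odd n)
    (hAut : ∀ φ : circulantOneK n k ≃g circulantOneK n k,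
      (∃ b, ∀ x, φ x = x + b) ∨ ∃ b, ∀ x, φ x = b - x)
    {α : Type*} (c : (circulantOneK n k).Coloring α)
    (hc : ∀ b, (∀ x, c (x + b) = c x) → b = 0) : c.IsDistinguishing := by
  intro φ hφ
  rcases hAut φ with ⟨b, hb⟩ | ⟨b, hb⟩
  · obtain rfl := hc b fun x => by rw [← hb, hφ]
    simpa using hb
  · obtain ⟨j, hj⟩ := hodd
    have hj0 : 2 * (j : ZMod n) + 1 = 0 := by
      have := ZMod.natCast_self n
      rw [hj] at this ⊢
      exact_mod_cast this
    -- Since `2j = -1`, this point is `(b - 1)/2`, which the reflection moves to its successor.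
    have h := hφ (-(j : ZMod n) * (b - 1))
    have hx : φ (-(j : ZMod n) * (b - 1)) = -(j : ZMod n) * (b - 1) + 1 := by
      rw [hb]
      linear_combination (b - 1) * hj0
    rw [hx] at h
    exact absurd h.symm (c.valid (circulantOneK_adj_add_one hn _))

/-- As `5² = -1` mod 13, multiplication by 5 is an extra automorphism. The coloring construction
fails for this pair. -/
theorem not_mulEquiv_dihedralGroup_thirteen_five :
    IsEmpty ((circulantOneK 13 5 ≃g circulantOneK 13 5) ≃* DihedralGroup 13) := by
  refine ⟨fun e => ?_⟩
  let φ : circulantOneK 13 5 ≃g circulantOneK 13 5 :=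
    ⟨⟨fun x => 5 * x, fun x => 8 * x, by decide, by decide⟩, by
      intro x y
      simp only [circulantGraph_adj, Equiv.coe_fn_mk]
      revert x y
      decide⟩
  rcases circulantOneK_iso_of_mulEquiv_dihedralGroup (by norm_num) ⟨e⟩ φ with ⟨b, hb⟩ | ⟨b, hb⟩
  · have h0 : (5 * 0 : ZMod 13) = 0 + b := hb 0
    have h1 : (5 * 1 : ZMod 13) = 1 + b := hb 1
    revert b
    decide
  · have h0 : (5 * 0 : ZMod 13) = b - 0 := hb 0
    have h1 : (5 * 1 : ZMod 13) = b - 1 := hb 1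
    revert b
    decide

theorem three_le_of_coloring (hn : 1 < n) (hodd : Odd n) {r : ℕ}
    (c : (circulantOneK n k).Coloring (Fin r)) : 3 ≤ r := by
  by_contra! hr
  have hstep (x : ZMod n) : c (x + 1) ≠ c x :=
    (c.valid (circulantOneK_adj_add_one hn x)).symm
  have htwo (x : ZMod n) : c (x + 2) = c x := by
    have h1 := hstep x
    have h2 := hstep (x + 1)
    rw [add_assoc, one_add_one_eq_two] at h2
    rw [ne_eq, Fin.ext_iff] at h1 h2
    rw [Fin.ext_iff]
    omega
  have heven (j : ℕ) : c (2 * (j : ZMod n)) = c 0 := by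
    induction j with
    | zero => simp
    | succ j ih =>
      rw [← ih, ← htwo (2 * (j : ZMod n))]
      push_cast
      ring_nf
  obtain ⟨j, hj⟩ := hodd
  have hj0 : 2 * (j : ZMod n) + 1 = 0 := by
    have := ZMod.natCast_self n
    rw [hj] at this ⊢
    exact_mod_cast this
  have := hstep (2 * (j : ZMod n))
  rw [hj0, heven] at this
  exact this rfl

end Automorphisms

/-! ### Height colorings and their periods -/

section Colorings

variable {n k : ℕ}

theorem exists_coloring_of_periodic [NeZero n] {α : Type*} (F : ℤ → α)
    (hF : Function.Periodic F (n : ℤ)) (h1 : ∀ i, F (i + 1) ≠ F i)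
    (hk : ∀ i, F (i + k) ≠ F i) :
    ∃ c : (circulantOneK n k).Coloring α, ∀ i : ℤ, c (i : ZMod n) = F i := by
  have hval (i : ℤ) : F ((i : ZMod n).val : ℤ) = F i := by
    rw [ZMod.val_intCast, Int.emod_def, mul_comm]
    exact hF.sub_int_mul_eq _
  refine ⟨Coloring.mk (fun x : ZMod n => F (x.val : ℤ)) ?_, hval⟩
  have aux (x y : ZMod n) (h : x - y ∈ ({(1 : ZMod n), (k : ZMod n)} : Set (ZMod n))) :
      F (x.val : ℤ) ≠ F (y.val : ℤ) := by
    obtain ⟨i, rfl⟩ := ZMod.intCast_surjective y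
    rcases h with h | h
    · obtain rfl : x = ((i + 1 : ℤ) : ZMod n) := by
        push_cast
        linear_combination h
      rw [hval, hval]
      exact h1 i
    · obtain rfl : x = ((i + k : ℤ) : ZMod n) := by
        push_cast
        linear_combination Set.mem_singleton_iff.1 h
      rw [hval, hval]
      exact hk i
  intro x y hxy
  rw [circulantGraph_adj] at hxy
  rcases hxy.2 with h | h
  · exact aux x y h
  · exact (aux y x h).symm

/-- The least integer of the parity of `i` that is at least `(n - 2 * m) * i / n`. -/
def slopeHeight (n m i : ℤ) : ℤ := i - 2 * (m * i / n)

theorem mul_slopeHeight (n m i : ℤ) :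
    n * slopeHeight n m i = (n - 2 * m) * i + 2 * (m * i % n) := by
  rw [slopeHeight, Int.emod_def]
  ring

theorem slopeHeight_add_self {n : ℤ} (hn : n ≠ 0) (m i : ℤ) :
    slopeHeight n m (i + n) = slopeHeight n m i + (n - 2 * m) := by
  rw [slopeHeight, slopeHeight, mul_add, Int.add_mul_ediv_right _ _ hn]
  ring

/-- The quantity is odd, and `n` times it differs from `v` by less than `2n`, so it lies strictly
between -3 and 3. The multiple of 6 affects neither parity nor the class mod 3. -/
theorem slopeHeight_add_sub_eq_or {n : ℤ} (hn : 0 < n) (m i : ℤ) {d v p : ℤ} (hd : Odd d)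
    (hv : (n - 2 * m) * d = v + 6 * n * p) (hvn : |v| ≤ n) :
    slopeHeight n m (i + d) - slopeHeight n m i - 6 * p = 1 ∨
      slopeHeight n m (i + d) - slopeHeight n m i - 6 * p = -1 := by
  have hodd : Odd (slopeHeight n m (i + d) - slopeHeight n m i - 6 * p) := by
    obtain ⟨j, rfl⟩ := hd
    exact ⟨j - m * (i + (2 * j + 1)) / n + m * i / n - 3 * p, by unfold slopeHeight; ring⟩
  have e1 := mul_slopeHeight n m i
  have e2 := mul_slopeHeight n m (i + d)
  have b1 := Int.emod_nonneg (m * i) hn.ne'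
  have b2 := Int.emod_lt_of_pos (m * i) hn
  have b3 := Int.emod_nonneg (m * (i + d)) hn.ne'
  have b4 := Int.emod_lt_of_pos (m * (i + d)) hn
  obtain ⟨hv1, hv2⟩ := abs_le.1 hvn
  set D := slopeHeight n m (i + d) - slopeHeight n m i - 6 * p with hD
  have hnD : n * D = v + 2 * (m * (i + d) % n - m * i % n) := by
    rw [hD]
    linear_combination e2 - e1 + hv
  have h3 : D < 3 := lt_of_mul_lt_mul_left (by linarith : n * D < n * 3) hn.le
  have h3' : -3 < D := lt_of_mul_lt_mul_left (by linarith : n * (-3) < n * D) hn.le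
  obtain ⟨j, hj⟩ := hodd
  omega

/-- With `|v| < n`, a rise of 1 would require a larger residue at `i + d`. -/
theorem slopeHeight_add_sub_of_max {n : ℤ} (hn : 0 < n) {m i : ℤ}
    (hi : ∀ j, m * j % n ≤ m * i % n) {d v p : ℤ} (hd : Odd d)
    (hv : (n - 2 * m) * d = v + 6 * n * p) (hvn : |v| < n) :
    slopeHeight n m (i + d) - slopeHeight n m i - 6 * p = -1 := by
  refine (slopeHeight_add_sub_eq_or hn m i hd hv hvn.le).resolve_left fun h => ?_
  have e1 := mul_slopeHeight n m i
  have e2 := mul_slopeHeight n m (i + d)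
  have := hi (i + d)
  have : n * 1 = v + 2 * (m * (i + d) % n - m * i % n) := by
    rw [← h]
    linear_combination e2 - e1 + hv
  linarith [(abs_lt.1 hvn).2]

theorem intCast_zmod_three_add_six_mul (a p e : ℤ) :
    ((a + 6 * p + e : ℤ) : ZMod 3) = a + e := by
  push_cast
  rw [show (6 : ZMod 3) = 0 from rfl]
  ring

theorem slopeHeight_cast_ne {n : ℤ} (hn : 0 < n) (m i : ℤ) {d v p : ℤ} (hd : Odd d)
    (hv : (n - 2 * m) * d = v + 6 * n * p) (hvn : |v| ≤ n) :
    (slopeHeight n m (i + d) : ZMod 3) ≠ slopeHeight n m i := by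
  rcases slopeHeight_add_sub_eq_or hn m i hd hv hvn with h | h
  · rw [show slopeHeight n m (i + d) = slopeHeight n m i + 6 * p + 1 by linarith,
      intCast_zmod_three_add_six_mul, ne_eq, add_eq_left]
    decide
  · rw [show slopeHeight n m (i + d) = slopeHeight n m i + 6 * p + (-1) by linarith,
      intCast_zmod_three_add_six_mul, ne_eq, add_eq_left]
    decide

theorem slopeHeight_cast_of_max {n : ℤ} (hn : 0 < n) {m i : ℤ}
    (hi : ∀ j, m * j % n ≤ m * i % n) {d v p : ℤ} (hd : Odd d)
    (hv : (n - 2 * m) * d = v + 6 * n * p) (hvn : |v| < n) :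
    (slopeHeight n m (i + d) : ZMod 3) = slopeHeight n m i - 1 := by
  have h := slopeHeight_add_sub_of_max hn hi hd hv hvn
  rw [show slopeHeight n m (i + d) = slopeHeight n m i + 6 * p + (-1) by linarith,
    intCast_zmod_three_add_six_mul]
  push_cast
  ring

theorem exists_coloring_slopeHeight [NeZero n] (hk : Odd k) {m t q : ℤ}
    (ht : (n : ℤ) - 2 * m = 3 * t) (htn : |3 * t| ≤ n) (hkt : |3 * t * k - 6 * n * q| ≤ n) :
    ∃ c : (circulantOneK n k).Coloring (ZMod 3),
      ∀ i : ℤ, c (i : ZMod n) = slopeHeight n m i := by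
  have hn : (0 : ℤ) < n := by exact_mod_cast NeZero.pos n
  refine exists_coloring_of_periodic (fun i => (slopeHeight n m i : ZMod 3)) ?_ ?_ ?_
  · intro i
    simp only
    rw [slopeHeight_add_self hn.ne', ht]
    push_cast
    rw [show (3 : ZMod 3) = 0 from rfl]
    ring
  · exact fun i => slopeHeight_cast_ne hn m i odd_one (p := 0) (by rw [ht]; ring) htn
  · exact fun i => slopeHeight_cast_ne hn m i (by exact_mod_cast hk)
      (p := q) (by rw [ht]; ring) hkt

/-- A translation that preserves a coloring of winding number one is trivial. -/
theorem translation_eq_zero_of_slopeHeight [NeZero n] {m : ℤ} (hm : (n : ℤ) - 2 * m = 3)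
    (hn3 : 3 ≤ n) (c : ZMod n → ZMod 3) (hc : ∀ i : ℤ, c (i : ZMod n) = slopeHeight n m i)
    {b : ZMod n} (hb : ∀ x, c (x + b) = c x) : b = 0 := by
  have hn : (0 : ℤ) < n := by exact_mod_cast NeZero.pos n
  obtain ⟨b, rfl⟩ := ZMod.intCast_surjective b
  have hdvd (i : ℤ) : (3 : ℤ) ∣ slopeHeight n m (i + b) - slopeHeight n m i := by
    have h := hb i
    rw [← Int.cast_add, hc, hc] at h
    rw [← Int.modEq_iff_dvd]
    exact ((ZMod.intCast_eq_intCast_iff _ _ 3).1 h).symm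
  have hstep (i : ℤ) := slopeHeight_add_sub_eq_or hn m i odd_one (v := 3) (p := 0)
    (by rw [hm]; ring) (by rw [abs_of_pos (by norm_num)]; exact_mod_cast hn3)
  have hconst (i : ℤ) : slopeHeight n m (i + b) - slopeHeight n m i =
      slopeHeight n m (0 + b) - slopeHeight n m 0 := by
    have hsucc (i : ℤ) : slopeHeight n m (i + 1 + b) - slopeHeight n m (i + 1) =
        slopeHeight n m (i + b) - slopeHeight n m i := by
      -- The two sides differ by 0 or ±2, and both are divisible by 3.
      have h1 := hstep i
      have h2 := hstep (i + b)
      have h3 := hdvd i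
      have h4 := hdvd (i + 1)
      rw [show i + b + 1 = i + 1 + b by ring] at h2
      omega
    induction i using Int.induction_on with
    | zero => rfl
    | succ i ih => rw [hsucc, ih]
    | pred i ih => rw [← ih, ← hsucc]; simp
  obtain ⟨K, hK⟩ := hdvd 0
  have hmul (j : ℕ) : slopeHeight n m (j * b) = slopeHeight n m 0 + j * (3 * K) := by
    induction j with
    | zero => simp
    | succ j ih =>
      have := hconst (j * b)
      rw [show ((j + 1 : ℕ) : ℤ) * b = j * b + b by push_cast; ring]
      push_cast
      linarith
  -- The height at `n * b` is computed twice: by `b`-steps and, as the residue vanishes there, from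
  -- the slope.
  have hnb := hmul n
  have e1 := mul_slopeHeight n m (n * b)
  have e0 := mul_slopeHeight n m 0
  rw [show m * ((n : ℤ) * b) = n * (m * b) by ring, Int.mul_emod_right, hnb, hm] at e1
  simp only [mul_zero, Int.zero_emod, add_zero] at e0 e1
  have : (n : ℤ) * (n * (3 * K)) = n * (3 * b) := by linear_combination e1 - e0
  have := mul_left_cancel₀ hn.ne' this
  rw [ZMod.intCast_zmod_eq_zero_iff_dvd]
  exact ⟨K, by linarith⟩

theorem exists_forall_mul_emod_le {n : ℤ} (hn : 0 < n) (m : ℤ) :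
    ∃ i, ∀ j, m * j % n ≤ m * i % n := by
  obtain ⟨-, ⟨i, rfl⟩, hi⟩ := Int.exists_greatest_of_bdd (P := fun r => ∃ i, r = m * i % n)
    ⟨n, by rintro _ ⟨i, rfl⟩; exact (Int.emod_lt_of_pos _ hn).le⟩ ⟨_, 0, rfl⟩
  exact ⟨i, fun j => hi _ ⟨j, rfl⟩⟩

/-- If a coloring of a group of odd order has a nontrivial period, then changing the color of one
element destroys all periods. -/
theorem translation_eq_zero_of_update {A α : Type*} [AddCommGroup A] [Finite A] [DecidableEq A]
    (hodd : Odd (Nat.card A)) (c : A → α) (v : A) {a : α} (ha : a ≠ c v)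
    {b₀ : A} (hb₀ : b₀ ≠ 0) (hper : ∀ x, c (x + b₀) = c x)
    {b : A} (hb : ∀ x, Function.update c v a (x + b) = Function.update c v a x) : b = 0 := by
  by_contra hb0
  have h2 (x : A) (hx : x ≠ 0) : x + x ≠ 0 := by
    intro h
    have h1 : addOrderOf x ∣ 2 := addOrderOf_dvd_of_nsmul_eq_zero (by rw [two_nsmul, h])
    have h3 : addOrderOf x ∣ Nat.card A := addOrderOf_dvd_natCard x
    have hco : Nat.Coprime 2 (Nat.card A) := (Nat.coprime_two_left).2 hodd
    have := Nat.eq_one_of_dvd_coprimes hco h1 h3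
    exact hx (AddMonoid.addOrderOf_eq_one_iff.1 this)
  have hc (x : A) (h1 : x ≠ v) (h2 : x + b ≠ v) : c (x + b) = c x := by
    have := hb x
    rwa [Function.update_of_ne h2, Function.update_of_ne h1] at this
  have hshift (x : A) : c (x + b₀ + b) = c (x + b) := by
    rw [add_right_comm, hper]
  -- The period `b₀` moves the comparison away from `v`, to `v + b₀` or, if `b` sends that to `v`,
  -- to `v + 2b₀`.
  have hv : c (v + b) = c v := by
    by_cases h : v + b₀ + b = v
    · have e : v + b₀ + b₀ + b ≠ v := by
        intro e
        exact hb₀ (by simpa [h] using (by abel : v + b₀ + b + b₀ = v + b₀ + b₀ + b).trans e)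
      have := hc (v + b₀ + b₀) (by simpa [add_assoc] using h2 b₀ hb₀) e
      rwa [hshift, hshift, hper, hper] at this
    · have := hc (v + b₀) (by simpa using hb₀) h
      rwa [hshift, hper] at this
  have := hb v
  rw [Function.update_self, Function.update_of_ne (by simpa using hb0), hv] at this
  exact ha this.symm

theorem exists_coloring_translation_eq_zero_of_lt [NeZero n] (hodd : Odd n) (hk : Odd k)
    {m t q : ℤ} (ht : (n : ℤ) - 2 * m = 3 * t) (htn : |3 * t| < n)
    (hkt : |3 * t * k - 6 * n * q| < n) :
    ∃ c : (circulantOneK n k).Coloring (ZMod 3), ∀ b, (∀ x, c (x + b) = c x) → b = 0 := by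
  have hn : (0 : ℤ) < n := by exact_mod_cast NeZero.pos n
  obtain ⟨c, hc⟩ := exists_coloring_slopeHeight hk ht htn.le hkt.le
  by_cases hper : ∀ b, (∀ x, c (x + b) = c x) → b = 0
  · exact ⟨c, hper⟩
  push Not at hper
  obtain ⟨b₀, hb₀, hb₀0⟩ := hper
  obtain ⟨i, hi⟩ := exists_forall_mul_emod_le hn m
  set v : ZMod n := (i : ZMod n) with hv
  have hkZ : Odd (k : ℤ) := by exact_mod_cast hk
  have hnb {d w p : ℤ} (hd : Odd d) (hw : (n - 2 * m) * d = w + 6 * n * p) (hwn : |w| < n) :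
      c (v + (d : ZMod n)) = c v - 1 := by
    rw [hv, ← Int.cast_add, hc, hc]
    exact slopeHeight_cast_of_max hn hi hd hw hwn
  have p1 : c (v + 1) = c v - 1 := by
    simpa using hnb odd_one (p := 0) (by rw [ht]; ring) htn
  have p2 : c (v + -1) = c v - 1 := by
    simpa using hnb (d := -1) odd_one.neg (w := -(3 * t)) (p := 0) (by rw [ht]; ring)
      (by rwa [abs_neg])
  have p3 : c (v + k) = c v - 1 := by
    simpa using hnb hkZ (p := q) (by rw [ht]; ring) hkt
  have p4 : c (v + -k) = c v - 1 := by
    simpa using hnb (d := -k) hkZ.neg (w := -(3 * t * k - 6 * n * q)) (p := -q)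
      (by rw [ht]; ring) (by rwa [abs_neg])
  have hadj (x : ZMod n) (h : (circulantOneK n k).Adj v x) : c x = c v - 1 := by
    rw [circulantGraph_adj] at h
    rcases h.2 with (h | h) | (h | h)
    · rw [← p2]; congr 1; linear_combination -h
    · rw [← p4]; congr 1; linear_combination -Set.mem_singleton_iff.1 h
    · rw [← p1]; congr 1; linear_combination h
    · rw [← p3]; congr 1; linear_combination Set.mem_singleton_iff.1 h
  have hne : c v + 1 ≠ c v - 1 := by generalize c v = a; revert a; decide
  refine ⟨Coloring.mk (Function.update c v (c v + 1)) ?_, fun b hb => ?_⟩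
  · intro x y hxy
    by_cases hx : x = v
    · subst hx
      rw [Function.update_self, Function.update_of_ne hxy.ne', hadj y hxy]
      exact hne
    · by_cases hy : y = v
      · subst hy
        rw [Function.update_self, Function.update_of_ne hx, hadj x hxy.symm]
        exact hne.symm
      · rw [Function.update_of_ne hx, Function.update_of_ne hy]
        exact c.valid hxy
  · exact translation_eq_zero_of_update (by rwa [Nat.card_zmod]) c v
      (by rw [ne_eq, add_eq_left]; decide) hb₀0 hb₀ hb

theorem exists_coloring_translation_eq_zero (hn : Odd n) (hk : Odd k) (hk2 : 2 < k)
    (hkn : 2 * k + 1 < n) (hex : ¬ (n = 13 ∧ k = 5)) :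
    ∃ c : (circulantOneK n k).Coloring (ZMod 3), ∀ b, (∀ x, c (x + b) = c x) → b = 0 := by
  have : NeZero n := ⟨by omega⟩
  obtain ⟨j, hj⟩ := hn
  obtain ⟨l, hl⟩ := id hk
  by_cases h3 : 3 * k ≤ n
  · have hm : (n : ℤ) - 2 * (j - 1) = 3 * 1 := by rw [hj]; push_cast; ring
    obtain ⟨c, hc⟩ := exists_coloring_slopeHeight hk hm (q := 0)
      (by rw [abs_le]; omega) (by rw [abs_le]; omega)
    exact ⟨c, fun b hb =>
      translation_eq_zero_of_slopeHeight (by rw [hm]; rfl) (by omega) c hc hb⟩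
  · obtain ⟨s, hs⟩ : ∃ s, n = 2 * k + s := ⟨n - 2 * k, by omega⟩
    have hs3 : 3 ≤ s := by omega
    set Q := (n - 3 * s) / (12 * s) with hQ
    have hQ1 : 12 * s * Q ≤ n - 3 * s := Nat.mul_div_le _ _
    have hQ2 : n - 3 * s < 12 * s * (Q + 1) := Nat.lt_mul_div_succ _ (by omega)
    have hQ1' : (12 * s * Q : ℤ) ≤ n - 3 * s := by
      have : 12 * s * Q + 3 * s ≤ n := by omega
      have : (12 * s * Q + 3 * s : ℤ) ≤ n := by exact_mod_cast this
      linarith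
    have hQ2' : (n : ℤ) < 12 * s * (Q + 1) + 3 * s := by
      have : n < 12 * s * (Q + 1) + 3 * s := by omega
      exact_mod_cast this
    have hQ3 : 36 * Q + 3 * s ≤ n ∧ (Q = 0 ∨ 45 ≤ n) := by
      have h36 : 36 * Q ≤ 12 * s * Q := Nat.mul_le_mul_right _ (by omega)
      omega
    have hsZ : (n : ℤ) = 2 * k + s := by exact_mod_cast hs
    have hbd : 3 * s < n := by omega
    have hbdZ : (3 * s : ℤ) < n := by exact_mod_cast hbd
    -- With `t = 4q + 1` and `2k = n - s`, the quantity `3tk - 6nq` is `3(n - st)/2`, so `n < 3st <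
    -- 5n` is needed. This `t` is the least one with `n < 3st`.
    refine exists_coloring_translation_eq_zero_of_lt (m := j - 6 * Q - 7) (t := 4 * (Q + 1) + 1)
      (q := Q + 1) ⟨j, hj⟩ hk (by rw [hj]; push_cast; ring) ?_ ?_
    -- The bound `3t < n` fails only for the excluded pair, where `3t = 15`.
    · rw [abs_lt]
      omega
    · have e : 2 * (3 * (4 * ((Q : ℤ) + 1) + 1) * k - 6 * n * (Q + 1)) =
          3 * n - 3 * s * (4 * (Q + 1) + 1) := by
        rw [hsZ]
        ring
      rw [abs_lt]
      constructor <;> linarith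

end Colorings

end SimpleGraph

theorem theorem7p6 (n k : ℕ) (hn : Odd n) (hk : Odd k)
    (hk_gt : 2 < k) (hk_lt : (k : ℚ) < ((n : ℚ) - 1) / 2)
    (hAut : Nonempty
      ((SimpleGraph.circulantOneK n k ≃g SimpleGraph.circulantOneK n k) ≃* DihedralGroup n)) :
    (SimpleGraph.circulantOneK n k).distinguishingChromaticNumber = 3 := by
  have hkn : 2 * k + 1 < n := by
    have : (2 * k + 1 : ℚ) < n := by linarith
    exact_mod_cast this
  have hex : ¬ (n = 13 ∧ k = 5) := by
    rintro ⟨rfl, rfl⟩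
    exact SimpleGraph.not_mulEquiv_dihedralGroup_thirteen_five.false hAut.some
  have hcol : (SimpleGraph.circulantOneK n k).DistinguishingColorable 3 := by
    obtain ⟨c, hc⟩ := SimpleGraph.exists_coloring_translation_eq_zero hn hk hk_gt hkn hex
    exact ⟨c, SimpleGraph.Coloring.isDistinguishing_of_translation (by omega) hn
      (SimpleGraph.circulantOneK_iso_of_mulEquiv_dihedralGroup (by omega) hAut) c hc⟩
  refine le_antisymm (iInf₂_le 3 hcol) (le_iInf₂ ?_)
  rintro r ⟨c, -⟩
  exact_mod_cast SimpleGraph.three_le_of_coloring (by omega) hn c
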